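/- Let $(\Omega,\mathcal F,\Pr)$ be a probability space with a filtration $(\mathcal F_n)_{n\ge 0}$, and let $(S,\mathcal S)$ be a measurable space whose $\sigma$-field is countably generated. Let $(f_n)_{n\ge1}$ and $(g_n)_{n\ge1}$ be $S$-valued sequences adapted to $(\mathcal F_n)$ (that is, $f_n,g_n$ are $\mathcal F_n$-measurable) that are tangent: for every $n\ge1$ and $A\in\mathcal S$, $\mathbb E(1_{\{f_n\in A\}}\mid\mathcal F_{n-1})=\mathbb E(1_{\{g_n\in A\}}\mid\mathcal F_{n-1})$ almost surely. Let $\lambda$ denote Lebesgue measure on $[0,1]^n$ and on $[0,1]^{\mathbb N}$. (1) Suppose that there is a map $\psi:S\to\mathbb R$ with $\mathcal S=\{\psi^{-1}(B): B\subseteq\mathbb R\text{ Borel}\}$ such that, for every $n$, the set $\psi(S)$ is measurable for the completion of the law of $\psi(f_n)$. (This holds automatically if $S$ is a standard Borel space.) Then there are Borel measurable maps $h_n:[0,1]^n\to S$ and $\phi_n:[0,1]^n\to[0,1]$, $n\ge 1$, such that $\phi_n(x_1,\dots,x_{n-1},\cdot)$ is a $\lambda$-preserving map of $[0,1]$ for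 almost every $(x_1,\dots,x_{n-1})$, and such that, with $$k_n(x_1,\dots,x_n)=h_n(x_1,\dots,x_{n-1},\phi_n(x_1,\dots,x_n)),$$ the sequence $(f_n,g_n)_{n\ge1}$ under $\Pr$ has the same law on $(S\times S)^{\mathbb N}$ as the sequence $(h_n(x_1,\dots,x_n),k_n(x_1,\dots,x_n))_{n\ge1}$ under $\lambda$ on $[0,1]^{\mathbb N}$. (2) If $S$ is a separable Banach space with its Borel $\sigma$-field, and $(f_n)$ is a martingale difference sequence with respect to $(\mathcal F_n)$ (each $f_n$ is Bochner integrable and $\mathbb E(f_n\mid\mathcal F_{n-1})=0$ for $n\ge1$), then $h_n$ and $\phi_n$ as in (1) can be chosen such that moreover, for every $n\ge1$ and almost every $(x_1,\dots,x_{n-1})$, the function $h_n(x_1,\dots,x_{n-1},\cdot)$ is integrable on $[0,1]$ and $$\int_0^1 h_n(x_1,\dots,x_n)\,dx_n=0 .$$ -/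

import Mathlib

open MeasureTheory ProbabilityTheory Set Filter
open scoped unitInterval

/-- Sequences are indexed from `0`: `f n` is the `(n+1)`-st term of a sequence `f₁, f₂, …`,
while the filtration starts with `ℱ 0`. So adaptedness says that `f n` is
`ℱ (n + 1)`-measurable. -/
def AdaptedSeq {Ω S : Type*} {mΩ : MeasurableSpace Ω} [MeasurableSpace S]
    (ℱ : Filtration ℕ mΩ) (f : ℕ → Ω → S) : Prop :=
  ∀ n, Measurable[ℱ (n + 1)] (f n)

/-- Two adapted sequences are tangent if the `n`-th terms have the same conditional law given
the σ-field that precedes them. -/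
structure TangentSeq {Ω S : Type*} {mΩ : MeasurableSpace Ω} [MeasurableSpace S]
    (P : Measure Ω) (ℱ : Filtration ℕ mΩ) (f g : ℕ → Ω → S) : Prop where
  adapted_left : AdaptedSeq ℱ f
  adapted_right : AdaptedSeq ℱ g
  condLaw_eq : ∀ n, ∀ A : Set S, MeasurableSet A →
    P⟦f n ⁻¹' A | ℱ n⟧ =ᵐ[P] P⟦g n ⁻¹' A | ℱ n⟧

/-- Martingale difference sequences (Bochner integrable, same indexing as above). -/
structure IsMartingaleDifference {Ω S : Type*} {mΩ : MeasurableSpace Ω} [MeasurableSpace S]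
    [NormedAddCommGroup S] [NormedSpace ℝ S] [CompleteSpace S]
    (P : Measure Ω) (ℱ : Filtration ℕ mΩ) (f : ℕ → Ω → S) : Prop where
  adapted : AdaptedSeq ℱ f
  integrable : ∀ n, Integrable (f n) P
  condExp_eq_zero : ∀ n, P[f n | ℱ n] =ᵐ[P] 0

/-- The point `(x₁, …, xₙ, t)` of the cube `[0,1]ⁿ⁺¹`. -/
def cubeSnoc {n : ℕ} (x : Fin n → I) (t : I) : Fin (n + 1) → I :=
  Fin.snoc (α := fun _ => I) x t

/-- The function `k(x₁, …, xₙ₊₁) = h(x₁, …, xₙ, φ(x₁, …, xₙ₊₁))`. -/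
def changeLast {S : Type*} {n : ℕ} (h : (Fin (n + 1) → I) → S) (φ : (Fin (n + 1) → I) → I) :
    (Fin (n + 1) → I) → S :=
  fun x => h (cubeSnoc (fun i => x i.castSucc) (φ x))

/-- Lebesgue measure on `[0,1]^ℕ`. -/
noncomputable def lebesgueCube : Measure (ℕ → I) :=
  Measure.infinitePi (fun _ : ℕ => (volume : Measure I))

/-- The projection of `[0,1]^ℕ` onto the first `n` coordinates. -/
def firstCoords (n : ℕ) (x : ℕ → I) : Fin n → I := fun i => x i

/-- `(h, φ)` represents the pair of sequences `(f, g)`: the law of `(fₙ, gₙ)ₙ`, as a measure on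
`(S × S)^ℕ`, is the law of `(hₙ, kₙ)ₙ` under Lebesgue measure on `[0,1]^ℕ`, where `kₙ` is obtained
from `hₙ` by replacing its last variable by `φₙ`, and `φₙ` is measure preserving in its last
variable for almost all values of the others. -/
structure IsTangentRepresentation {Ω S : Type*} {mΩ : MeasurableSpace Ω} [MeasurableSpace S]
    (P : Measure Ω) (f g : ℕ → Ω → S)
    (h : (n : ℕ) → (Fin (n + 1) → I) → S) (φ : (n : ℕ) → (Fin (n + 1) → I) → I) : Prop where
  measurable_h : ∀ n, Measurable (h n)
  measurable_φ : ∀ n, Measurable (φ n)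
  measurePreserving_φ : ∀ n, ∀ᵐ x : Fin n → I,
    MeasurePreserving (fun t : I => φ n (cubeSnoc x t)) volume volume
  law_eq : P.map (fun ω n => (f n ω, g n ω)) =
    lebesgueCube.map (fun x n =>
      (h n (firstCoords (n + 1) x), changeLast (h n) (φ n) (firstCoords (n + 1) x)))

/-!
The law of a process is reproduced by sampling each term from its conditional law given the past,
with a fresh uniform variable at each step (`map_drivenPath`, `map_drivenSequence`). For the
process `(fₙ, gₙ)` in a standard Borel space, tangency says that the conditional law `κ w` of
`(fₙ, gₙ)` given the past `w` has equal marginals (`TangentSeq.condDistrib_fst_snd`): conditioning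
on the past of the two sequences is coarser than conditioning on `ℱ n`.

It remains to sample a coupling `κ w` of a law with itself in the special form `(H w, H w ∘ Φ w)`
with `Φ w` preserving Lebesgue measure (`exists_measurable_coupling`). To this end split the
uniform variable `t` into three independent ones `p t`, `r t`, `s t`, and let `H w t = q w (p t)`
have the first marginal of `κ w` as its law. Use `r t` to sample `Y` so that `(H w t, Y)` has law
`κ w`, and then use `s t` to sample a point `Φ w t` from the conditional law of `t` given
`H w t`, at the value `Y`. As `Y` and `H w` have the same law, `Φ w` is again uniform, and
`H w (Φ w t) = Y` almost surely.

If the σ-field of `S` is only generated by a map `ψ` into `ℝ`, the real sequences `ψ(fₙ)`, `ψ(gₙ)`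
are represented and then lifted through a measurable almost sure right inverse of `ψ`; this does
not change the law, because measurable sets do not distinguish points with the same image under `ψ`
(`TangentSeq.exists_representation_of_comap`).

In the construction the law of `hₙ(x₁, …, xₙ, ·)` is the conditional law of `fₙ` at a random past,
so for a martingale difference sequence it is integrable and centred
(`IsMartingaleDifference.condDistrib_integral_eq_zero`).
-/

/-! ### Couplings of a law with itself -/

/-- A Markov kernel into a product disintegrates, and its conditional kernel is sampled by one
uniform variable: each `κ w` is the law of `(X, c w (X, U))`, where `X` has the first marginal
of `κ w` and `U` is uniform and independent of `X`. -/
lemma exists_measurable_sample_snd {α β γ : Type*} [MeasurableSpace α] [MeasurableSpace β]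
    [StandardBorelSpace β] [MeasurableSpace γ] [StandardBorelSpace γ] [Nonempty γ]
    (κ : Kernel α (β × γ)) [IsMarkovKernel κ] :
    ∃ c : α → β × I → γ, Measurable (Function.uncurry c) ∧
      ∀ w, ((κ w).fst.prod (volume : Measure I)).map (fun p => (p.1, c w p)) = κ w := by
  obtain ⟨c, hc, hcκ⟩ := κ.condKernel.exists_measurable_map_eq_unitInterval
  refine ⟨fun w p => c (w, p.1) p.2, ?_, fun w => ?_⟩
  · exact hc.comp (f := fun z : α × β × I => ((z.1, z.2.1), z.2.2)) (by fun_prop)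
  have hcw : Measurable (fun p : β × I => c (w, p.1) p.2) :=
    hc.comp (f := fun z : β × I => ((w, z.1), z.2)) (by fun_prop)
  ext E hE
  rw [Measure.map_apply (by fun_prop) hE, Measure.prod_apply ((measurable_fst.prodMk hcw) hE)]
  conv_rhs => rw [← κ.disintegrate κ.condKernel, Kernel.compProd_apply hE, Kernel.fst_apply]
  refine lintegral_congr fun b => ?_
  rw [← hcκ (w, b), Measure.map_apply hc.of_uncurry_left (measurable_prodMk_left hE)]
  rfl

/-- Three independent uniform variables can be extracted from a single one. -/
lemma exists_three_uniform :
    ∃ p r s : I → I, Measurable p ∧ Measurable r ∧ Measurable s ∧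
      (volume : Measure I).map (fun t => ((p t, r t), s t)) =
        ((volume : Measure I).prod volume).prod volume := by
  obtain ⟨d, hd, hdv⟩ := Measure.exists_measurable_map_eq
    (((volume : Measure I).prod (volume : Measure I)).prod (volume : Measure I))
  exact ⟨fun t => (d t).1.1, fun t => (d t).1.2, fun t => (d t).2, by fun_prop, by fun_prop,
    by fun_prop, hdv⟩

/-- A coupling `κ w` of a law with itself is realised on `[0,1]` by a function `H w` and its
composition with a measure preserving map `Φ w`. -/
lemma exists_measurable_coupling {α S : Type*} [MeasurableSpace α] [MeasurableSpace S]
    [StandardBorelSpace S] [Nonempty S] (κ : Kernel α (S × S)) [IsMarkovKernel κ] :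
    ∃ (H : α → I → S) (Φ : α → I → I), Measurable (Function.uncurry H) ∧
      Measurable (Function.uncurry Φ) ∧
      ∀ w, (κ w).fst = (κ w).snd → MeasurePreserving (Φ w) volume volume ∧
        (volume : Measure I).map (fun t => (H w t, H w (Φ w t))) = κ w := by
  obtain ⟨p, r, s, hp, hr, hs, hprs⟩ := exists_three_uniform
  obtain ⟨q, hq, hqκ⟩ := (Kernel.fst κ).exists_measurable_map_eq_unitInterval
  obtain ⟨a, ha, haκ⟩ := exists_measurable_sample_snd κ
  have hH : Measurable (fun z : α × I => q z.1 (p z.2)) :=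
    hq.comp (f := fun z : α × I => (z.1, p z.2)) (by fun_prop)
  -- The joint law of `(H w, t)`: its conditional kernel selects a random point of a fibre of `H w`.
  let L : Kernel α (S × I) := (Kernel.id ×ₖ Kernel.const α (volume : Measure I)).map
    (fun z : α × I => (q z.1 (p z.2), z.2))
  have : IsMarkovKernel L := Kernel.IsMarkovKernel.map _ (by fun_prop)
  have hL w : L w = (volume : Measure I).map (fun t => (q w (p t), t)) := by
    rw [Kernel.map_apply _ (by fun_prop), Kernel.prod_apply, Kernel.id_apply, Kernel.const_apply,
      Measure.dirac_prod, Measure.map_map (by fun_prop) (by fun_prop)]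
    rfl
  obtain ⟨b, hb, hbL⟩ := exists_measurable_sample_snd L
  refine ⟨fun w t => q w (p t), fun w t => b w (a w (q w (p t), r t), s t), hH, ?_, ?_⟩
  · have h1 : Measurable (fun z : α × I => a z.1 (q z.1 (p z.2), r z.2)) :=
      ha.comp (f := fun z : α × I => (z.1, (q z.1 (p z.2), r z.2))) (by fun_prop)
    exact hb.comp (f := fun z : α × I => (z.1, (a z.1 (q z.1 (p z.2), r z.2), s z.2)))
      (by fun_prop)
  intro w hw
  have hqw : Measurable (q w) := hq.of_uncurry_left
  have haw : Measurable (a w) := ha.of_uncurry_left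
  have hbw : Measurable (b w) := hb.of_uncurry_left
  have hpv : (volume : Measure I).map p = volume := by
    have := congrArg (fun m => (Measure.fst m).fst) hprs
    simp only [Measure.fst_prod] at this
    rwa [Measure.fst_map_prodMk hs, Measure.fst_map_prodMk hr] at this
  have hκfst : (κ w).fst = (volume : Measure I).map (q w) := by
    rw [hqκ, Kernel.fst_apply]; rfl
  have hLfst : (L w).fst = (κ w).fst := by
    rw [hL, Measure.fst_map_prodMk (Y := fun t => t) measurable_id, hκfst]
    conv_rhs => rw [← hpv]
    rw [Measure.map_map hqw hp]
    rfl
  -- The first two uniform variables produce the pair `(H w, Y)` of law `κ w`.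
  have hXY : (volume : Measure I).map (fun t => ((q w (p t), a w (q w (p t), r t)), s t)) =
      (κ w).prod volume := by
    have h1 : (volume : Measure I).map (fun t => ((q w (p t), r t), s t)) =
        ((κ w).fst.prod volume).prod volume := by
      have h2 := congrArg (Measure.map (Prod.map (Prod.map (q w) id) id)) hprs
      rw [← Measure.map_prod_map _ _ (by fun_prop) (by fun_prop),
        ← Measure.map_prod_map _ _ (by fun_prop) (by fun_prop), ← hκfst,
        Measure.map_map (by fun_prop) (by fun_prop), Measure.map_id] at h2
      exact h2
    have h3 := congrArg (Measure.map
      (Prod.map (fun x : S × I => (x.1, a w x)) (id : I → I))) h1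
    rw [← Measure.map_prod_map _ _ (by fun_prop) (by fun_prop), haκ,
        Measure.map_map (by fun_prop) (by fun_prop), Measure.map_id] at h3
    exact h3
  have hXY' : (volume : Measure I).map (fun t => (q w (p t), a w (q w (p t), r t))) = κ w := by
    have := congrArg Measure.fst hXY
    rwa [Measure.fst_map_prodMk hs, Measure.fst_prod] at this
  -- The third one moves `Y` to a point of its fibre, without changing the law of `(H w, t)`.
  have hYΦ : (volume : Measure I).map
      (fun t => (a w (q w (p t), r t), b w (a w (q w (p t), r t), s t))) = L w := by
    have h1 := congrArg (Measure.map (Prod.map Prod.snd id)) hXY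
    rw [← Measure.map_prod_map _ _ (by fun_prop) (by fun_prop), ← Measure.snd, ← hw, ← hLfst,
      Measure.map_map (by fun_prop) (by fun_prop), Measure.map_id] at h1
    have h2 := congrArg (Measure.map (fun x : S × I => (x.1, b w x))) h1
    rw [hbL, Measure.map_map (by fun_prop) (by fun_prop)] at h2
    exact h2
  have hΦ : Measurable (fun t => b w (a w (q w (p t), r t), s t)) := by fun_prop
  refine ⟨⟨hΦ, ?_⟩, ?_⟩
  · have h1 := congrArg Measure.snd hYΦ
    rw [Measure.snd_map_prodMk (by fun_prop), hL, Measure.snd_map_prodMk (by fun_prop)] at h1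
    simpa using h1
  · rw [← hXY']
    refine Measure.map_congr ?_
    have hae : ∀ᵐ z ∂(L w), z.1 = q w (p z.2) := by
      rw [hL]
      refine (ae_map_iff (by fun_prop) ?_).2 (by simp)
      exact measurableSet_eq_fun (by fun_prop) (by fun_prop)
    rw [← hYΦ] at hae
    filter_upwards [ae_of_ae_map (by fun_prop) hae] with t ht
    rw [← ht]

/-! ### Conditional laws of tangent sequences -/

/-- If `f` and `g` have the same conditional law given `m`, then so have they given an
`m`-measurable variable `V`. -/
lemma map_prodMk_eq_of_condLaw_eq {Ω S E : Type*} {m mΩ : MeasurableSpace Ω} [MeasurableSpace S]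
    [MeasurableSpace E] {P : Measure Ω} [IsProbabilityMeasure P]
    (hm : m ≤ mΩ) {V : Ω → E} (hV : Measurable[m] V) {f g : Ω → S} (hf : Measurable f)
    (hg : Measurable g)
    (h : ∀ A : Set S, MeasurableSet A → P⟦f ⁻¹' A | m⟧ =ᵐ[P] P⟦g ⁻¹' A | m⟧) :
    P.map (fun ω => (V ω, f ω)) = P.map (fun ω => (V ω, g ω)) := by
  have hV' : Measurable V := hV.mono hm le_rfl
  have key : ∀ f : Ω → S, Measurable f → ∀ (A : Set E) (B : Set S), MeasurableSet A →
      MeasurableSet B → P.map (fun ω => (V ω, f ω)) (A ×ˢ B) =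
        ENNReal.ofReal (∫ ω in V ⁻¹' A, (P⟦f ⁻¹' B | m⟧) ω ∂P) := by
    intro f hf A B hA hB
    rw [Measure.map_apply (by fun_prop) (hA.prod hB), setIntegral_condExp hm
      ((integrable_const _).indicator (hf hB)) (hV hA), setIntegral_indicator (hf hB)]
    simp [mk_preimage_prod]
  have : IsProbabilityMeasure (P.map (fun ω => (V ω, f ω))) :=
    Measure.isProbabilityMeasure_map (by fun_prop)
  refine Measure.ext_prod fun {A B} hA hB => ?_
  rw [key f hf A B hA hB, key g hg A B hA hB,
    setIntegral_congr_ae (hV' hA) ((h B hB).mono fun ω hω _ => hω)]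

/-- The history `(X₀, …, Xₙ₋₁)` of a process before time `n`. -/
def history {Ω Z : Type*} (X : ℕ → Ω → Z) (n : ℕ) (ω : Ω) : Fin n → Z := fun i => X i ω

@[fun_prop]
lemma measurable_history {Ω Z : Type*} [MeasurableSpace Ω] [MeasurableSpace Z] {X : ℕ → Ω → Z}
    (hX : ∀ n, Measurable (X n)) (n : ℕ) : Measurable (history X n) :=
  measurable_pi_lambda _ fun i => hX i

section Tangent

variable {Ω S : Type*} {mΩ : MeasurableSpace Ω} [MeasurableSpace S] {P : Measure Ω}
  {ℱ : Filtration ℕ mΩ} {f g : ℕ → Ω → S}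

lemma AdaptedSeq.measurable (hf : AdaptedSeq ℱ f) (n : ℕ) : Measurable (f n) :=
  (hf n).mono (ℱ.le _) le_rfl

lemma TangentSeq.measurable_history (hfg : TangentSeq P ℱ f g) (n : ℕ) :
    Measurable[ℱ n] (history (fun n ω => (f n ω, g n ω)) n) :=
  @measurable_pi_lambda _ _ _ (ℱ n) _ _ fun i =>
    (((hfg.adapted_left i).mono (ℱ.mono i.2) le_rfl).prodMk
      ((hfg.adapted_right i).mono (ℱ.mono i.2) le_rfl))

/-- The conditional law of `(fₙ, gₙ)` given the history of both sequences couples a law with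
itself, which is the conditional law of `fₙ`. -/
lemma TangentSeq.condDistrib_fst_snd [IsProbabilityMeasure P] [StandardBorelSpace S] [Nonempty S]
    (hfg : TangentSeq P ℱ f g) (n : ℕ) :
    ∀ᵐ w ∂(P.map (history (fun n ω => (f n ω, g n ω)) n)),
      (condDistrib (fun ω => (f n ω, g n ω)) (history (fun n ω => (f n ω, g n ω)) n) P w).fst =
        condDistrib (f n) (history (fun n ω => (f n ω, g n ω)) n) P w ∧
      (condDistrib (fun ω => (f n ω, g n ω)) (history (fun n ω => (f n ω, g n ω)) n) P w).snd =
        condDistrib (f n) (history (fun n ω => (f n ω, g n ω)) n) P w := by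
  set V := history (fun n ω => (f n ω, g n ω)) n
  have hf := hfg.adapted_left.measurable n
  have hg := hfg.adapted_right.measurable n
  have hfg' : condDistrib (g n) V P = condDistrib (f n) V P := by
    rw [condDistrib, condDistrib]
    congr 1
    exact (map_prodMk_eq_of_condLaw_eq (ℱ.le n) (hfg.measurable_history n) hf hg
      (hfg.condLaw_eq n)).symm
  have h1 := condDistrib_comp (mβ := inferInstance) (μ := P) V (Y := fun ω => (f n ω, g n ω))
    (by fun_prop) (f := Prod.fst) (by fun_prop)
  have h2 := condDistrib_comp (mβ := inferInstance) (μ := P) V (Y := fun ω => (f n ω, g n ω))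
    (by fun_prop) (f := Prod.snd) (by fun_prop)
  filter_upwards [h1, h2] with w hw1 hw2
  rw [Kernel.map_apply _ (by fun_prop)] at hw1 hw2
  exact ⟨hw1.symm, by rw [← hfg']; exact hw2.symm⟩

end Tangent

/-! ### Sampling a process from its conditional laws -/

/-- The path driven by the inputs `x₁, …, xₙ`, when `N k w t` is the value at time `k` after the
history `w` with input `t`. -/
def drivenPath {Z : Type*} (N : (n : ℕ) → (Fin n → Z) → I → Z) :
    (n : ℕ) → (Fin n → I) → Fin n → Z
  | 0, _ => Fin.elim0
  | n + 1, x => Fin.snoc (α := fun _ => Z) (drivenPath N n (fun i => x i.castSucc))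
      (N n (drivenPath N n (fun i => x i.castSucc)) (x (Fin.last n)))

lemma measurable_finSnoc {Z : Type*} [MeasurableSpace Z] (n : ℕ) :
    Measurable (fun p : (Fin n → Z) × Z => (Fin.snoc (α := fun _ => Z) p.1 p.2 : Fin (n + 1) → Z))
    := by
  refine measurable_pi_lambda _ fun i => ?_
  refine Fin.lastCases ?_ (fun i => ?_) i
  · simpa using measurable_snd
  · simp only [Fin.snoc_castSucc]; fun_prop

/-- Lebesgue measure on `[0,1]ⁿ⁺¹` is the product of those on `[0,1]ⁿ` and `[0,1]`. -/
lemma map_cubeSnoc_volume (n : ℕ) :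
    ((volume : Measure (Fin n → I)).prod (volume : Measure I)).map (fun p => cubeSnoc p.1 p.2) =
      volume := by
  have h := (volume_preserving_piFinSuccAbove (fun _ : Fin (n + 1) => I) (Fin.last n)).symm.comp
    (Measure.measurePreserving_swap (μ := (volume : Measure (Fin n → I)))
      (ν := (volume : Measure I)))
  convert! h.map_eq using 2
  ext p i
  simp [cubeSnoc, MeasurableEquiv.piFinSuccAbove, Fin.insertNthEquiv]

@[fun_prop]
lemma measurable_cubeSnoc {n : ℕ} :
    Measurable (fun p : (Fin n → I) × I => cubeSnoc p.1 p.2) :=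
  measurable_finSnoc n

lemma drivenPath_cubeSnoc {Z : Type*} (N : (n : ℕ) → (Fin n → Z) → I → Z) (n : ℕ)
    (x : Fin n → I) (t : I) :
    drivenPath N (n + 1) (cubeSnoc x t) = Fin.snoc (α := fun _ => Z) (drivenPath N n x)
      (N n (drivenPath N n x) t) := by
  simp [drivenPath, cubeSnoc]

@[fun_prop]
lemma measurable_drivenPath {Z : Type*} [MeasurableSpace Z] {N : (n : ℕ) → (Fin n → Z) → I → Z}
    (hN : ∀ n, Measurable (Function.uncurry (N n))) (n : ℕ) : Measurable (drivenPath N n) := by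
  induction n with
  | zero => exact measurable_pi_lambda _ fun i => i.elim0
  | succ n ih =>
    have h1 : Measurable (fun x : Fin (n + 1) → I => drivenPath N n (fun i => x i.castSucc)) :=
      ih.comp (by fun_prop)
    exact (measurable_finSnoc n).comp
      (h1.prodMk ((hN n).comp (h1.prodMk (measurable_pi_apply (Fin.last n)))))

/-- Sampling each step from the conditional law given the history reproduces the law of the
process up to any finite time. -/
lemma map_drivenPath {Ω Z : Type*} {mΩ : MeasurableSpace Ω} [MeasurableSpace Z]
    [StandardBorelSpace Z] [Nonempty Z] {P : Measure Ω} [IsProbabilityMeasure P] {X : ℕ → Ω → Z}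
    (hX : ∀ n, Measurable (X n)) {N : (n : ℕ) → (Fin n → Z) → I → Z}
    (hN : ∀ n, Measurable (Function.uncurry (N n)))
    (hNX : ∀ n, ∀ᵐ w ∂(P.map (history X n)),
      (volume : Measure I).map (N n w) = condDistrib (X n) (history X n) P w) (n : ℕ) :
    (volume : Measure (Fin n → I)).map (drivenPath N n) = P.map (history X n) := by
  induction n with
  | zero =>
    have := Measure.isProbabilityMeasure_map (μ := (volume : Measure (Fin 0 → I)))
      (measurable_drivenPath hN 0).aemeasurable
    have := Measure.isProbabilityMeasure_map (μ := P) (measurable_history hX 0).aemeasurable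
    ext A hA
    rcases A.eq_empty_or_nonempty with rfl | hA'
    · simp
    · rw [Subsingleton.eq_univ_of_nonempty hA']; simp
  | succ n ih =>
    have hstep : ((P.map (history X n)).prod (volume : Measure I)).map
        (fun p => (p.1, N n p.1 p.2)) = P.map (fun ω => (history X n ω, X n ω)) := by
      have hmeas : Measurable (fun p : (Fin n → Z) × I => (p.1, N n p.1 p.2)) :=
        measurable_fst.prodMk (hN n)
      rw [← compProd_map_condDistrib (X := history X n) (hX n).aemeasurable]
      ext E hE
      rw [Measure.map_apply hmeas hE, Measure.prod_apply (hmeas hE), Measure.compProd_apply hE]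
      refine lintegral_congr_ae ?_
      filter_upwards [hNX n] with w hw
      rw [← hw, Measure.map_apply (hN n).of_uncurry_left (measurable_prodMk_left hE)]
      rfl
    have hsnoc : history X (n + 1) =
        fun ω => Fin.snoc (α := fun _ => Z) (history X n ω) (X n ω) := by
      ext ω i
      refine Fin.lastCases ?_ (fun i => ?_) i <;> simp [history]
    have hX' := hX n
    rw [hsnoc]
    change _ = P.map ((fun p : (Fin n → Z) × Z => (Fin.snoc (α := fun _ => Z) p.1 p.2 :
      Fin (n + 1) → Z)) ∘ (fun ω => (history X n ω, X n ω)))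
    rw [← Measure.map_map (measurable_finSnoc n) (by fun_prop), ← hstep, ← ih,
      ← map_cubeSnoc_volume, Measure.map_map (by fun_prop) (by fun_prop)]
    have hp : ((volume : Measure (Fin n → I)).map (drivenPath N n)).prod (volume : Measure I) =
        ((volume : Measure (Fin n → I)).prod (volume : Measure I)).map
          (Prod.map (drivenPath N n) id) := by
      rw [← Measure.map_prod_map _ _ (by fun_prop) (by fun_prop), Measure.map_id]
    have hm1 : Measurable (fun p : (Fin n → Z) × I => (p.1, N n p.1 p.2)) :=
      measurable_fst.prodMk (hN n)
    rw [hp, Measure.map_map hm1 (by fun_prop),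
      Measure.map_map (measurable_finSnoc n) (hm1.comp (by fun_prop))]
    congr 1
    ext1 p
    exact drivenPath_cubeSnoc N n p.1 p.2

/-- A finite measure on a space of sequences is determined by its finite-dimensional marginals. -/
lemma measure_ext_of_map_fin {Z : Type*} [MeasurableSpace Z] {μ ν : Measure (ℕ → Z)}
    [IsFiniteMeasure μ]
    (h : ∀ n, μ.map (fun z (i : Fin n) => z i) = ν.map (fun z (i : Fin n) => z i)) : μ = ν := by
  refine IsProjectiveLimit.unique (P := fun J => μ.map J.restrict) (fun J => rfl) fun J => ?_
  obtain ⟨n, hn⟩ : ∃ n, ∀ j ∈ J, j < n :=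
    ⟨J.sup id + 1, fun j hj => Nat.lt_succ_of_le (Finset.le_sup (f := id) hj)⟩
  have hJ : (J.restrict : (ℕ → Z) → (J → Z)) =
      (fun (w : Fin n → Z) (j : J) => w ⟨j, hn j j.2⟩) ∘ (fun z (i : Fin n) => z i) := rfl
  change ν.map J.restrict = μ.map J.restrict
  rw [hJ, ← Measure.map_map (by fun_prop) (by fun_prop),
    ← Measure.map_map (by fun_prop) (by fun_prop), h n]

instance : IsProbabilityMeasure lebesgueCube := by unfold lebesgueCube; infer_instance

@[fun_prop]
lemma measurable_firstCoords (n : ℕ) : Measurable (firstCoords n) := by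
  unfold firstCoords; fun_prop

lemma map_firstCoords (n : ℕ) : lebesgueCube.map (firstCoords n) = volume := by
  refine (Measure.pi_eq fun s hs => ?_).symm
  have hpre : firstCoords n ⁻¹' Set.univ.pi s =
      Set.pi (Finset.range n) (fun k => if hk : k < n then s ⟨k, hk⟩ else Set.univ) := by
    ext x
    simp only [mem_preimage, Set.mem_pi, mem_univ, true_imp_iff, firstCoords, Finset.coe_range,
      Set.mem_Iio]
    exact ⟨fun h k hk => by simpa [hk] using h ⟨k, hk⟩, fun h i => by simpa using h i i.2⟩
  rw [Measure.map_apply (by fun_prop) (MeasurableSet.univ_pi hs), hpre, lebesgueCube,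
    Measure.infinitePi_pi, Finset.prod_range]
  · simp
  · intro k hk
    simp only [Finset.mem_range] at hk
    simpa [hk] using hs ⟨k, hk⟩

lemma drivenPath_apply {Z : Type*} (N : (n : ℕ) → (Fin n → Z) → I → Z) (x : ℕ → I) (n : ℕ)
    (i : Fin n) :
    drivenPath N n (firstCoords n x) i =
      N i (drivenPath N i (firstCoords i x)) (x i) := by
  induction n with
  | zero => exact i.elim0
  | succ n ih =>
    refine Fin.lastCases ?_ (fun i => ?_) i
    · simp only [drivenPath, Fin.snoc_last]; rfl
    · simp only [drivenPath, Fin.snoc_castSucc]; exact ih i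

/-- Sampling each step from the conditional law given the history reproduces the law of the
whole process. -/
lemma map_drivenSequence {Ω Z : Type*} {mΩ : MeasurableSpace Ω} [MeasurableSpace Z]
    [StandardBorelSpace Z] [Nonempty Z] {P : Measure Ω} [IsProbabilityMeasure P] {X : ℕ → Ω → Z}
    (hX : ∀ n, Measurable (X n)) {N : (n : ℕ) → (Fin n → Z) → I → Z}
    (hN : ∀ n, Measurable (Function.uncurry (N n)))
    (hNX : ∀ n, ∀ᵐ w ∂(P.map (history X n)),
      (volume : Measure I).map (N n w) = condDistrib (X n) (history X n) P w) :
    lebesgueCube.map (fun x n => N n (drivenPath N n (firstCoords n x)) (x n)) =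
      P.map (fun ω n => X n ω) := by
  have hm : Measurable (fun (x : ℕ → I) n => N n (drivenPath N n (firstCoords n x)) (x n)) :=
    measurable_pi_lambda _ fun n => (hN n).comp
      (((measurable_drivenPath hN n).comp (by fun_prop)).prodMk (measurable_pi_apply n))
  have := Measure.isProbabilityMeasure_map (μ := lebesgueCube) hm.aemeasurable
  refine measure_ext_of_map_fin fun n => ?_
  rw [Measure.map_map (by fun_prop) hm, Measure.map_map (by fun_prop) (by fun_prop)]
  change _ = P.map (history X n)
  rw [← map_drivenPath hX hN hNX n, ← map_firstCoords,
    Measure.map_map (by fun_prop) (by fun_prop)]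
  congr 1
  ext1 x
  ext1 i
  exact (drivenPath_apply N x n i).symm

/-! ### Sequences in a standard Borel space -/

/-- Tangent sequences in a standard Borel space have a representation in which the law of
`hₙ(x₁, …, xₙ, ·)` is the conditional law of `fₙ` given that the past of both sequences is
`W n (x₁, …, xₙ)`. -/
theorem TangentSeq.exists_representation {Ω S : Type*} {mΩ : MeasurableSpace Ω}
    [MeasurableSpace S] [StandardBorelSpace S] [Nonempty S] {P : Measure Ω}
    [IsProbabilityMeasure P] {ℱ : Filtration ℕ mΩ} {f g : ℕ → Ω → S} (hfg : TangentSeq P ℱ f g) :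
    ∃ (h : (n : ℕ) → (Fin (n + 1) → I) → S) (φ : (n : ℕ) → (Fin (n + 1) → I) → I)
      (W : (n : ℕ) → (Fin n → I) → Fin n → S × S),
      IsTangentRepresentation P f g h φ ∧ ∀ n, Measurable (W n) ∧
        (volume : Measure (Fin n → I)).map (W n) =
          P.map (history (fun n ω => (f n ω, g n ω)) n) ∧
        ∀ᵐ x : Fin n → I, (volume : Measure I).map (fun t => h n (cubeSnoc x t)) =
          condDistrib (f n) (history (fun n ω => (f n ω, g n ω)) n) P (W n x) := by
  set X : ℕ → Ω → S × S := fun n ω => (f n ω, g n ω)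
  have hf := hfg.adapted_left.measurable
  have hg := hfg.adapted_right.measurable
  have hX : ∀ n, Measurable (X n) := fun n => (hf n).prodMk (hg n)
  choose H Φ hH hΦ hHΦ using fun n => exists_measurable_coupling
    (condDistrib (X n) (history X n) P)
  let N : (n : ℕ) → (Fin n → S × S) → I → S × S := fun n w t => (H n w t, H n w (Φ n w t))
  have hN : ∀ n, Measurable (Function.uncurry (N n)) := fun n =>
    (hH n).prodMk ((hH n).comp (f := fun z : (Fin n → S × S) × I => (z.1, Φ n z.1 z.2))
      (measurable_fst.prodMk (hΦ n)))
  have hmarg n := hfg.condDistrib_fst_snd n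
  have hNX : ∀ n, ∀ᵐ w ∂(P.map (history X n)),
      (volume : Measure I).map (N n w) = condDistrib (X n) (history X n) P w := by
    intro n
    filter_upwards [hmarg n] with w hw
    exact (hHΦ n w (hw.1.trans hw.2.symm)).2
  have hW n := measurable_drivenPath hN n
  have hWmap n := map_drivenPath hX hN hNX n
  have hWae : ∀ n {p : (Fin n → S × S) → Prop}, (∀ᵐ w ∂(P.map (history X n)), p w) →
      ∀ᵐ x : Fin n → I, p (drivenPath N n x) := by
    intro n p hp
    rw [← hWmap n] at hp
    exact ae_of_ae_map (hW n).aemeasurable hp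
  have hargs : ∀ n, Measurable (fun x : Fin (n + 1) → I =>
      (drivenPath N n (fun i => x i.castSucc), x (Fin.last n))) := fun n =>
    ((hW n).comp (by fun_prop)).prodMk (measurable_pi_apply _)
  refine ⟨fun n x => H n (drivenPath N n (fun i => x i.castSucc)) (x (Fin.last n)),
    fun n x => Φ n (drivenPath N n (fun i => x i.castSucc)) (x (Fin.last n)),
    fun n => drivenPath N n, ⟨fun n => (hH n).comp (hargs n), fun n => (hΦ n).comp (hargs n),
      fun n => ?_, ?_⟩, fun n => ⟨hW n, hWmap n, ?_⟩⟩
  · filter_upwards [hWae n (hmarg n)] with x hx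
    simpa [cubeSnoc] using (hHΦ n _ (hx.1.trans hx.2.symm)).1
  · change P.map (fun ω n => X n ω) = _
    rw [← map_drivenSequence hX hN hNX]
    congr 1
    ext1 x
    ext1 n
    simp only [N, changeLast, cubeSnoc, firstCoords, Fin.snoc_castSucc, Fin.snoc_last]
    rfl
  · filter_upwards [hWae n (hmarg n), hWae n (hNX n)] with x hx hx'
    simp only [cubeSnoc, Fin.snoc_castSucc, Fin.snoc_last]
    rw [← hx.1, ← hx', Measure.fst_map_prodMk]
    exact (hH n).of_uncurry_left.comp (hΦ n).of_uncurry_left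

/-! ### State spaces generated by a real function -/

section Comap

variable {S : Type*} [mS : MeasurableSpace S] {ψ : S → ℝ}

lemma measurable_of_comap_borel_eq (hψ : MeasurableSpace.comap ψ (borel ℝ) = mS) :
    Measurable ψ := by
  rw [measurable_iff_comap_le, BorelSpace.measurable_eq (α := ℝ), hψ]

/-- If almost every value of `X` lies in the range of `ψ`, which generates the σ-field of `S`, and
this range is null-measurable, then `ψ` has a measurable almost sure right inverse. -/
lemma exists_measurable_ae_rightInverse {Ω : Type*} [MeasurableSpace Ω] [Nonempty S]
    (hψ : MeasurableSpace.comap ψ (borel ℝ) = mS) {P : Measure Ω} {X : Ω → S} (hX : Measurable X)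
    (hr : NullMeasurableSet (range ψ) (P.map (fun ω => ψ (X ω)))) :
    ∃ s : ℝ → S, Measurable s ∧ ∀ᵐ y ∂P.map (fun ω => ψ (X ω)), ψ (s y) = y := by
  classical
  have hψm := measurable_of_comap_borel_eq hψ
  have hψX : Measurable (fun ω => ψ (X ω)) := hψm.comp hX
  obtain ⟨B, hBr, hB, hBae⟩ := hr.exists_measurable_subset_ae_eq
  obtain ⟨s₀⟩ := ‹Nonempty S›
  have hinv : ∀ y ∈ B, ψ (B.piecewise (Function.invFun ψ) (fun _ => s₀) y) = y := fun y hy => by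
    rw [piecewise_eq_of_mem _ _ _ hy]
    exact Function.invFun_eq (hBr hy)
  refine ⟨B.piecewise (Function.invFun ψ) (fun _ => s₀), ?_, ?_⟩
  · have hcomp : ψ ∘ B.piecewise (Function.invFun ψ) (fun _ => s₀) =
        B.piecewise id (fun _ => ψ s₀) := by
      ext y
      by_cases hy : y ∈ B
      · simpa [hy] using hinv y hy
      · simp [hy]
    rw [measurable_iff_comap_le, ← hψ, MeasurableSpace.comap_comp, hcomp,
      ← BorelSpace.measurable_eq (α := ℝ), ← measurable_iff_comap_le]
    exact measurable_id.piecewise hB measurable_const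
  -- The complement of the range has empty preimage, so null-measurability makes it a null set.
  · have hrange : ∀ᵐ y ∂P.map (fun ω => ψ (X ω)), y ∈ range ψ := by
      rw [ae_iff]
      change P.map (fun ω => ψ (X ω)) (range ψ)ᶜ = 0
      rw [Measure.map_apply₀ hψX.aemeasurable hr.compl]
      simp [preimage]
    filter_upwards [hrange, hBae.mem_iff] with y hy hyB
    exact hinv y (hyB.2 hy)

/-- If `ψ` generates the σ-field of `S`, a law on `(S × S)^ℕ` is determined by its image
under `ψ`, although `ψ` need not be injective. -/
lemma measure_ext_of_map_comap (hψ : MeasurableSpace.comap ψ (borel ℝ) = mS)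
    {μ ν : Measure (ℕ → S × S)}
    (h : μ.map (fun z n => (ψ (z n).1, ψ (z n).2)) = ν.map (fun z n => (ψ (z n).1, ψ (z n).2))) :
    μ = ν := by
  have hψm := measurable_of_comap_borel_eq hψ
  have hΨ : Measurable (fun (z : ℕ → S × S) n => (ψ (z n).1, ψ (z n).2)) := by fun_prop
  have hcomap : (MeasurableSpace.pi : MeasurableSpace (ℕ → S × S)) ≤
      MeasurableSpace.comap (fun (z : ℕ → S × S) n => (ψ (z n).1, ψ (z n).2))
        MeasurableSpace.pi := by
    simp only [MeasurableSpace.pi, Prod.instMeasurableSpace, MeasurableSpace.prod, ← hψ,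
      MeasurableSpace.comap_iSup, MeasurableSpace.comap_sup, MeasurableSpace.comap_comp,
      BorelSpace.measurable_eq (α := ℝ)]
    exact le_rfl
  ext E hE
  obtain ⟨C, hC, rfl⟩ := hcomap E hE
  rw [← Measure.map_apply hΨ hC, h, Measure.map_apply hΨ hC]

end Comap

lemma TangentSeq.comp {Ω S T : Type*} {mΩ : MeasurableSpace Ω} [MeasurableSpace S]
    [MeasurableSpace T] {P : Measure Ω} {ℱ : Filtration ℕ mΩ} {f g : ℕ → Ω → S}
    (hfg : TangentSeq P ℱ f g) {ψ : S → T} (hψ : Measurable ψ) :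
    TangentSeq P ℱ (fun n ω => ψ (f n ω)) (fun n ω => ψ (g n ω)) where
  adapted_left n := hψ.comp (hfg.adapted_left n)
  adapted_right n := hψ.comp (hfg.adapted_right n)
  condLaw_eq n _ hA := hfg.condLaw_eq n _ (hψ hA)

lemma TangentSeq.map_eq {Ω S : Type*} {mΩ : MeasurableSpace Ω} [MeasurableSpace S]
    {P : Measure Ω} [IsProbabilityMeasure P] {ℱ : Filtration ℕ mΩ} {f g : ℕ → Ω → S}
    (hfg : TangentSeq P ℱ f g) (n : ℕ) : P.map (f n) = P.map (g n) := by
  have h := congrArg Measure.snd (map_prodMk_eq_of_condLaw_eq (ℱ.le n) (V := fun _ => ())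
    measurable_const (hfg.adapted_left.measurable n) (hfg.adapted_right.measurable n)
    (hfg.condLaw_eq n))
  rwa [Measure.snd_map_prodMk measurable_const, Measure.snd_map_prodMk measurable_const] at h

lemma measurable_changeLast {S : Type*} [MeasurableSpace S] {n : ℕ} {h : (Fin (n + 1) → I) → S}
    {φ : (Fin (n + 1) → I) → I} (hh : Measurable h) (hφ : Measurable φ) :
    Measurable (changeLast h φ) := by
  unfold changeLast
  exact hh.comp (measurable_cubeSnoc.comp (f := fun x : Fin (n + 1) → I =>
    ((fun i : Fin n => x i.castSucc), φ x)) (by fun_prop))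

/-- A representation of the real sequences `ψ(fₙ)`, `ψ(gₙ)` lifts to one of `fₙ`, `gₙ`. -/
theorem TangentSeq.exists_representation_of_comap {Ω S : Type*} {mΩ : MeasurableSpace Ω}
    [mS : MeasurableSpace S] {P : Measure Ω} [IsProbabilityMeasure P] {ℱ : Filtration ℕ mΩ}
    {f g : ℕ → Ω → S} (hfg : TangentSeq P ℱ f g) {ψ : S → ℝ}
    (hψ : MeasurableSpace.comap ψ (borel ℝ) = mS)
    (hr : ∀ n, NullMeasurableSet (range ψ) (P.map (fun ω => ψ (f n ω)))) :
    ∃ (h : (n : ℕ) → (Fin (n + 1) → I) → S) (φ : (n : ℕ) → (Fin (n + 1) → I) → I),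
      IsTangentRepresentation P f g h φ := by
  have hψm := measurable_of_comap_borel_eq hψ
  have hf := hfg.adapted_left.measurable
  have hg := hfg.adapted_right.measurable
  have : Nonempty S := (nonempty_of_isProbabilityMeasure P).map (f 0)
  choose s hs hsψ using fun n => exists_measurable_ae_rightInverse hψ (hf n) (hr n)
  have hψfg := hfg.comp hψm
  obtain ⟨h, φ, -, hrep, -⟩ := hψfg.exists_representation
  have hk n := measurable_changeLast (hrep.measurable_h n) (hrep.measurable_φ n)
  have hh n := hrep.measurable_h n
  have hlaw n : lebesgueCube.map (fun x => (h n (firstCoords (n + 1) x),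
      changeLast (h n) (φ n) (firstCoords (n + 1) x))) =
        P.map (fun ω => (ψ (f n ω), ψ (g n ω))) := by
    have h1 := congrArg (Measure.map (fun z : ℕ → ℝ × ℝ => z n)) hrep.law_eq
    rw [Measure.map_map (by fun_prop) (by fun_prop),
      Measure.map_map (by fun_prop) (by fun_prop)] at h1
    exact h1.symm
  have hH : ∀ᵐ x ∂lebesgueCube, ∀ n, ψ (s n (h n (firstCoords (n + 1) x))) =
      h n (firstCoords (n + 1) x) := by
    refine ae_all_iff.2 fun n => ?_
    have h1 := congrArg Measure.fst (hlaw n)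
    rw [Measure.fst_map_prodMk (by fun_prop), Measure.fst_map_prodMk (by fun_prop)] at h1
    have h2 := hsψ n
    rw [← h1] at h2
    exact ae_of_ae_map (by fun_prop) h2
  have hK : ∀ᵐ x ∂lebesgueCube, ∀ n,
      ψ (s n (changeLast (h n) (φ n) (firstCoords (n + 1) x))) =
        changeLast (h n) (φ n) (firstCoords (n + 1) x) := by
    refine ae_all_iff.2 fun n => ?_
    have h1 := congrArg Measure.snd (hlaw n)
    rw [Measure.snd_map_prodMk (by fun_prop), Measure.snd_map_prodMk (by fun_prop)] at h1
    have h2 := hsψ n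
    rw [hψfg.map_eq n, ← h1] at h2
    exact ae_of_ae_map (by fun_prop) h2
  refine ⟨fun n x => s n (h n x), φ, fun n => (hs n).comp (hh n), hrep.measurable_φ,
    hrep.measurePreserving_φ, ?_⟩
  change P.map _ = lebesgueCube.map (fun x n => (s n (h n (firstCoords (n + 1) x)),
    s n (changeLast (h n) (φ n) (firstCoords (n + 1) x))))
  refine measure_ext_of_map_comap hψ ?_
  rw [Measure.map_map (by fun_prop) (by fun_prop), Measure.map_map (by fun_prop) (by fun_prop)]
  refine hrep.law_eq.trans (Measure.map_congr ?_)
  filter_upwards [hH, hK] with x hx hx'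
  ext n
  · exact (hx n).symm
  · exact (hx' n).symm

/-! ### Martingale differences -/

/-- The conditional law of a martingale difference given a coarser σ-field is integrable and
centred. -/
lemma IsMartingaleDifference.condDistrib_integral_eq_zero {Ω S E : Type*}
    {mΩ : MeasurableSpace Ω} [MeasurableSpace S] [NormedAddCommGroup S] [NormedSpace ℝ S]
    [CompleteSpace S] [SecondCountableTopology S] [BorelSpace S] [MeasurableSpace E]
    {P : Measure Ω} [IsProbabilityMeasure P] {ℱ : Filtration ℕ mΩ} {f : ℕ → Ω → S}
    (hf : IsMartingaleDifference P ℱ f) {n : ℕ} {V : Ω → E} (hV : Measurable[ℱ n] V) :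
    ∀ᵐ w ∂P.map V, Integrable (fun y => y) (condDistrib (f n) V P w) ∧
      ∫ y, y ∂condDistrib (f n) V P w = 0 := by
  have hV' : Measurable V := hV.mono (ℱ.le n) le_rfl
  have hfm : Measurable (f n) := (hf.adapted n).mono (ℱ.le _) le_rfl
  have hint : Integrable (fun z : E × S => z.2) (P.map (fun ω => (V ω, f n ω))) :=
    (integrable_map_measure (by fun_prop) (by fun_prop)).2 (hf.integrable n)
  refine (hint.condDistrib_ae_map hfm.aemeasurable).and ?_
  have hzero : P[f n | MeasurableSpace.comap V inferInstance] =ᵐ[P] 0 :=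
    (condExp_condExp_of_le (measurable_iff_comap_le.1 hV) (ℱ.le n)).symm.trans
      ((condExp_congr_ae (hf.condExp_eq_zero n)).trans (by rw [condExp_zero]))
  have hmeas : StronglyMeasurable (fun w => ∫ y, y ∂condDistrib (f n) V P w) :=
    StronglyMeasurable.integral_condDistrib (f := fun z : E × S => z.2)
      measurable_snd.stronglyMeasurable
  refine (ae_map_iff hV'.aemeasurable
    (measurableSet_eq_fun hmeas.measurable measurable_const)).2 ?_
  filter_upwards [condExp_ae_eq_integral_condDistrib' hV' (hf.integrable n), hzero] with ω h1 h2
  rw [← h1, h2]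
  rfl

theorem theorem4p1 {Ω S : Type*} {mΩ : MeasurableSpace Ω} [mS : MeasurableSpace S]
    [MeasurableSpace.CountablyGenerated S]
    (P : Measure Ω) [IsProbabilityMeasure P] (ℱ : Filtration ℕ mΩ)
    (f g : ℕ → Ω → S) (hfg : TangentSeq P ℱ f g) :
    ((∃ ψ : S → ℝ, MeasurableSpace.comap ψ (borel ℝ) = mS ∧
        ∀ n, NullMeasurableSet (Set.range ψ) (P.map (fun ω => ψ (f n ω)))) →
      ∃ (h : (n : ℕ) → (Fin (n + 1) → I) → S) (φ : (n : ℕ) → (Fin (n + 1) → I) → I),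
        IsTangentRepresentation P f g h φ) ∧
    (∀ [NormedAddCommGroup S] [NormedSpace ℝ S] [CompleteSpace S]
        [TopologicalSpace.SeparableSpace S] [BorelSpace S],
      IsMartingaleDifference P ℱ f →
      ∃ (h : (n : ℕ) → (Fin (n + 1) → I) → S) (φ : (n : ℕ) → (Fin (n + 1) → I) → I),
        IsTangentRepresentation P f g h φ ∧
        ∀ n, ∀ᵐ x : Fin n → I,
          Integrable (fun t : I => h n (cubeSnoc x t)) volume ∧
            ∫ t : I, h n (cubeSnoc x t) = 0) := by
  refine ⟨fun ⟨ψ, hψ, hr⟩ => hfg.exists_representation_of_comap hψ hr, ?_⟩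
  intro _ _ _ _ _ hmd
  have : SecondCountableTopology S := UniformSpace.secondCountable_of_separable S
  obtain ⟨h, φ, W, hrep, hW⟩ := hfg.exists_representation
  refine ⟨h, φ, hrep, fun n => ?_⟩
  obtain ⟨hWm, hWlaw, hlaw⟩ := hW n
  have hmean := hmd.condDistrib_integral_eq_zero (hfg.measurable_history n)
  rw [← hWlaw] at hmean
  filter_upwards [ae_of_ae_map hWm.aemeasurable hmean, hlaw] with x hx hx'
  have hhx : Measurable (fun t => h n (cubeSnoc x t)) :=
    (hrep.measurable_h n).comp (measurable_cubeSnoc.comp measurable_prodMk_left)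
  rw [← hx'] at hx
  exact ⟨(integrable_map_measure (by fun_prop) hhx.aemeasurable).1 hx.1,
    (integral_map hhx.aemeasurable (by fun_prop)).symm.trans hx.2⟩
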